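/- Let $n\ge 1$ and let $M$ be a smooth Hausdorff manifold (without boundary) of dimension $2n+1$ with a smooth Riemannian metric $g$ and Levi-Civita connection $\nabla$, and put $R_{X,Y}Z=\nabla_X\nabla_YZ-\nabla_Y\nabla_XZ-\nabla_{[X,Y]}Z$. Let $(\varphi,Q,\xi,\eta,g)$ be a weak nearly Sasakian structure on $M$, that is: $\varphi$ is a smooth $(1,1)$-tensor field, $Q$ is a smooth nonsingular $(1,1)$-tensor field, $\xi$ is a smooth vector field and $\eta$ is a smooth $1$-form such that $$\varphi^2=-Q+\eta\otimes\xi,\qquad \eta(\xi)=1,\qquad Q\xi=\xi,\qquad \varphi(\ker\eta)\subset\ker\eta,$$ $$g(\varphi X,\varphi Y)=g(X,QY)-\eta(X)\eta(Y),$$ $$(\nabla_Y\varphi)Z+(\nabla_Z\varphi)Y=2g(Y,Z)\,\xi-\eta(Z)Y-\eta(Y)Z$$ for all smooth vector fields $X,Y,Z$. Put $\widetilde Q=Q-\mathrm{id}_{TM}$ and assume that $$R_{\widetilde QX,\,Y}Z\in\ker\eta\qquad\text{for all } x\in M,\ X\in T_xM,\ Y,Z\in\ker\eta_x .$$ Then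 $g(R_{\xi,Z}\,\varphi X,\varphi Y)=0$ for all $x\in M$ and all $X,Y,Z\in T_xM$. Moreover, the distribution $\ker\eta$ is curvature invariant: $R_{X,Y}Z\in\ker\eta$ for all $x\in M$ and all $X,Y,Z\in\ker\eta_x$. -/

import Mathlib

open Bundle Manifold
open scoped ContDiff

noncomputable section

section WeakNearlySasakian

variable {E : Type*} [NormedAddCommGroup E] [NormedSpace ℝ E]
  {M : Type*} [TopologicalSpace M] [ChartedSpace E M] [IsManifold 𝓘(ℝ, E) ∞ M]

/-- `X` is a smooth vector field on `M`. -/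
def IsSmoothVectorField (X : Π x : M, TangentSpace 𝓘(ℝ, E) x) : Prop :=
  ContMDiff 𝓘(ℝ, E) (𝓘(ℝ, E).prod 𝓘(ℝ, E)) ∞
    (fun x ↦ (TotalSpace.mk' E x (X x) : TangentBundle 𝓘(ℝ, E) M))

/-- `T` is a smooth `(1,1)`-tensor field on `M`: a smooth section of the bundle `End(TM)`. -/
def IsSmoothEndField
    (T : Π x : M, TangentSpace 𝓘(ℝ, E) x →L[ℝ] TangentSpace 𝓘(ℝ, E) x) : Prop :=
  ContMDiff 𝓘(ℝ, E) (𝓘(ℝ, E).prod 𝓘(ℝ, E →L[ℝ] E)) ∞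
    (fun x ↦ TotalSpace.mk' (E →L[ℝ] E)
      (E := fun x : M ↦ TangentSpace 𝓘(ℝ, E) x →L[ℝ] TangentSpace 𝓘(ℝ, E) x) x (T x))

/-- `α` is a smooth `1`-form on `M`: a smooth section of the bundle `T*M`. -/
def IsSmoothOneForm (α : Π x : M, TangentSpace 𝓘(ℝ, E) x →L[ℝ] ℝ) : Prop :=
  ContMDiff 𝓘(ℝ, E) (𝓘(ℝ, E).prod 𝓘(ℝ, E →L[ℝ] ℝ)) ∞
    (fun x ↦ TotalSpace.mk' (E →L[ℝ] ℝ)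
      (E := fun x : M ↦ TangentSpace 𝓘(ℝ, E) x →L[ℝ] Bundle.Trivial M ℝ x) x (α x))

variable (E M) in
/-- A weak almost contact structure `(φ, Q, ξ, η)` on the smooth manifold `M`. -/
structure WeakAlmostContactStructure where
  /-- the `(1,1)`-tensor `φ` -/
  phi : Π x : M, TangentSpace 𝓘(ℝ, E) x →L[ℝ] TangentSpace 𝓘(ℝ, E) x
  /-- the nonsingular `(1,1)`-tensor `Q` -/
  Q : Π x : M, TangentSpace 𝓘(ℝ, E) x →L[ℝ] TangentSpace 𝓘(ℝ, E) x
  /-- the Reeb vector field `ξ` -/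
  xi : Π x : M, TangentSpace 𝓘(ℝ, E) x
  /-- the `1`-form `η` -/
  eta : Π x : M, TangentSpace 𝓘(ℝ, E) x →L[ℝ] ℝ
  smooth_phi : IsSmoothEndField phi
  smooth_Q : IsSmoothEndField Q
  smooth_xi : IsSmoothVectorField xi
  smooth_eta : IsSmoothOneForm eta
  Q_nonsingular : ∀ x, Function.Bijective (Q x)
  phi_phi : ∀ x v, phi x (phi x v) = - Q x v + eta x v • xi x
  eta_xi : ∀ x, eta x (xi x) = 1
  Q_xi : ∀ x, Q x (xi x) = xi x
  phi_mem_ker : ∀ x v, eta x v = 0 → eta x (phi x v) = 0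

/-- The "small" tensor `Q̃ = Q - id`. -/
def WeakAlmostContactStructure.Qtilde (S : WeakAlmostContactStructure E M) (x : M) :
    TangentSpace 𝓘(ℝ, E) x →L[ℝ] TangentSpace 𝓘(ℝ, E) x :=
  S.Q x - ContinuousLinearMap.id ℝ (TangentSpace 𝓘(ℝ, E) x)

/-- The vector field `R_{X,Y} Z = ∇_X ∇_Y Z - ∇_Y ∇_X Z - ∇_{[X,Y]} Z`
(recall that `cov Z x (X x)` is `∇_X Z` at `x`). -/
def curvatureField (cov : CovariantDerivative 𝓘(ℝ, E) E (TangentSpace 𝓘(ℝ, E) : M → Type _))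
    (X Y Z : Π x : M, TangentSpace 𝓘(ℝ, E) x) : Π x : M, TangentSpace 𝓘(ℝ, E) x :=
  fun x ↦ cov (fun y ↦ cov Z y (Y y)) x (X x) - cov (fun y ↦ cov Z y (X y)) x (Y x)
    - cov Z x (VectorField.mlieBracket 𝓘(ℝ, E) X Y x)

/-- The vector field `(∇_X T) Y = ∇_X (T Y) - T (∇_X Y)`, for a `(1,1)`-tensor field `T`. -/
def covDerivEnd (cov : CovariantDerivative 𝓘(ℝ, E) E (TangentSpace 𝓘(ℝ, E) : M → Type _))
    (T : Π x : M, TangentSpace 𝓘(ℝ, E) x →L[ℝ] TangentSpace 𝓘(ℝ, E) x)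
    (X Y : Π x : M, TangentSpace 𝓘(ℝ, E) x) : Π x : M, TangentSpace 𝓘(ℝ, E) x :=
  fun x ↦ cov (fun y ↦ T y (Y y)) x (X x) - T x (cov Y x (X x))

variable [FiniteDimensional ℝ E]
  [RiemannianBundle (fun x : M ↦ TangentSpace 𝓘(ℝ, E) x)]
  [IsContMDiffRiemannianBundle 𝓘(ℝ, E) ∞ E (fun x : M ↦ TangentSpace 𝓘(ℝ, E) x)]

/-- `cov` is the Levi-Civita connection of the Riemannian manifold `M`: for all smooth vector
fields, `∇_X Y` is smooth, `X g(Y,Z) = g(∇_X Y, Z) + g(Y, ∇_X Z)` and `∇_X Y - ∇_Y X = [X, Y]`. -/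
structure IsLeviCivita
    (cov : CovariantDerivative 𝓘(ℝ, E) E (TangentSpace 𝓘(ℝ, E) : M → Type _)) : Prop where
  smooth : ∀ X Y : Π x : M, TangentSpace 𝓘(ℝ, E) x,
    IsSmoothVectorField X → IsSmoothVectorField Y →
      IsSmoothVectorField (fun x ↦ cov Y x (X x))
  metric : ∀ X Y Z : Π x : M, TangentSpace 𝓘(ℝ, E) x,
    IsSmoothVectorField X → IsSmoothVectorField Y → IsSmoothVectorField Z → ∀ x : M,
      d% (fun y : M ↦ (inner ℝ (Y y) (Z y) : ℝ)) x (X x) =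
        inner ℝ (cov Y x (X x)) (Z x) + inner ℝ (Y x) (cov Z x (X x))
  torsion_free : ∀ X Y : Π x : M, TangentSpace 𝓘(ℝ, E) x,
    IsSmoothVectorField X → IsSmoothVectorField Y → ∀ x : M,
      cov Y x (X x) - cov X x (Y x) = VectorField.mlieBracket 𝓘(ℝ, E) X Y x

/-- The Riemannian metric is compatible with `(φ, Q, ξ, η)`, i.e. `(φ, Q, ξ, η, g)` is a weak
almost contact metric structure: `g(φX, φY) = g(X, QY) - η(X) η(Y)`. -/
def WeakAlmostContactStructure.IsMetric (S : WeakAlmostContactStructure E M) : Prop :=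
  ∀ (x : M) (v w : TangentSpace 𝓘(ℝ, E) x),
    inner ℝ (S.phi x v) (S.phi x w) = inner ℝ v (S.Q x w) - S.eta x v * S.eta x w

/-- A weak nearly Sasakian structure: a weak almost contact metric structure with
`(∇_Y φ) Z + (∇_Z φ) Y = 2 g(Y,Z) ξ - η(Z) Y - η(Y) Z` for all smooth vector fields `Y`, `Z`,
where `∇ = cov` is to be the Levi-Civita connection. -/
structure WeakAlmostContactStructure.IsWeakNearlySasakian (S : WeakAlmostContactStructure E M)
    (cov : CovariantDerivative 𝓘(ℝ, E) E (TangentSpace 𝓘(ℝ, E) : M → Type _)) : Prop where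
  isMetric : S.IsMetric
  nearly : ∀ Y Z : Π x : M, TangentSpace 𝓘(ℝ, E) x,
    IsSmoothVectorField Y → IsSmoothVectorField Z → ∀ x : M,
      covDerivEnd cov S.phi Y Z x + covDerivEnd cov S.phi Z Y x =
        (2 * inner ℝ (Y x) (Z x)) • S.xi x - S.eta x (Z x) • Y x - S.eta x (Y x) • Z x

end WeakNearlySasakian

end

/-!
The smooth vector fields on `M` form a module over the ring of smooth functions, and the argument is
carried out there: it uses only the calculus of the metric, the directional derivatives and the
connection, collected in the structure `LeviCivitaModule`. Write `R(X,Y,Z,U) = g(R_{X,Y}Z, U)`.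

Put `A(W;Y,Z,U) = g((∇²_{W,Y}φ)Z, U)`. It is skew in `Z, U` because `φ` is; its part symmetric in
`Y, Z` is found by differentiating the nearly Sasakian identity; its part skew in `W, Y` is given
by the Ricci identity. Subtracting the tensor that `A` would be if `(∇_Yφ)Z` were the Sasakian
expression `g(Y,Z)ξ - η(Z)Y` leaves a tensor totally skew in its last three arguments. Combined
with the pair symmetry of `R`, this yields that
`R(φW,Y,Z,U) + R(W,φY,Z,U) + R(W,Y,φZ,U) + R(W,Y,Z,φU)` is the sum of a Kulkarni-Nomizu product of
`g` with `L_ξ g` and a totally skew `4`-tensor. Both the left-hand side and the product satisfy the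
first Bianchi identity, so the skew tensor vanishes (`LeviCivitaModule.curv₄_phi_sum`). It is not
needed that `ξ` is Killing: as `∇_ξ ξ = 0` and `|ξ| = 1`, the product vanishes when `U = ξ` and
`W, Y ⊥ ξ`.

Consequently the trilinear form `T(X,Y,Z) = R(X,Y,Z,ξ)` on `ker η` is annihilated by the derivation
`a + b + c`, where `a, b, c` apply `φ` in the three slots. The hypothesis on `Q - id`, with the
skew symmetry and the Bianchi identity of `T`, says that `T` does not change when `Q` is applied in
any slot, so that `a² = b² = c² = -1` on `T`. Then `ab T = T / 2`, whence `T = a²b² T = T / 4`, and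
`T = 0` (`LeviCivitaModule.curv₄_xi_eq_zero_of_horizontal`). Splitting vector fields into their
components along `ξ` and in `ker η` gives both claims.
-/

/-! ### Modules with a metric and a Levi-Civita connection -/

/-- An algebraic model of the smooth vector fields `V` of a Riemannian manifold, as a module over its
ring `F` of smooth functions. The Lie bracket is not part of the data: as the connection has no
torsion, it is `[X, Y] = ∇_X Y - ∇_Y X`, and `jacobi` is the Jacobi identity for this expression. -/
structure LeviCivitaModule (F V : Type*) [CommRing F] [AddCommGroup V] [Module F V] where
  /-- the metric -/
  g : V →ₗ[F] V →ₗ[F] F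
  /-- `D X f` is the derivative of `f` along `X` -/
  D : V →+ F →+ F
  /-- `nabla X Y` is `∇_X Y` -/
  nabla : V →+ V →+ V
  g_symm : ∀ X Y, g X Y = g Y X
  D_mul : ∀ X a b, D X (a * b) = a * D X b + b * D X a
  nabla_smul_left : ∀ (a : F) X Y, nabla (a • X) Y = a • nabla X Y
  nabla_smul_right : ∀ X (a : F) Y, nabla X (a • Y) = a • nabla X Y + D X a • Y
  D_g : ∀ X Y Z, D X (g Y Z) = g (nabla X Y) Z + g Y (nabla X Z)
  jacobi : ∀ X Y Z,
    nabla X (nabla Y Z - nabla Z Y) - nabla (nabla Y Z - nabla Z Y) X =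
      nabla (nabla X Y - nabla Y X) Z - nabla Z (nabla X Y - nabla Y X) +
      (nabla Y (nabla X Z - nabla Z X) - nabla (nabla X Z - nabla Z X) Y)

namespace LeviCivitaModule

variable {F V : Type*} [CommRing F] [AddCommGroup V] [Module F V] (L : LeviCivitaModule F V)

/-- The curvature `R_{X,Y} Z = ∇_X ∇_Y Z - ∇_Y ∇_X Z - ∇_{[X,Y]} Z`. -/
def curv (X Y Z : V) : V :=
  L.nabla X (L.nabla Y Z) - L.nabla Y (L.nabla X Z) - L.nabla (L.nabla X Y - L.nabla Y X) Z

/-- The covariant curvature tensor `g(R_{X,Y} Z, U)`. -/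
def curv₄ (X Y Z U : V) : F := L.g (L.curv X Y Z) U

lemma curv_swap (X Y Z : V) : L.curv X Y Z = -L.curv Y X Z := by
  simp only [curv, map_sub, AddMonoidHom.sub_apply]
  abel

lemma curv_bianchi (X Y Z : V) : L.curv X Y Z + L.curv Y Z X + L.curv Z X Y = 0 := by
  have h := sub_eq_zero.2 (L.jacobi X Y Z)
  rw [← h]
  simp only [curv, map_sub, AddMonoidHom.sub_apply]
  abel

lemma curv_smul_left (a : F) (X Y Z : V) : L.curv (a • X) Y Z = a • L.curv X Y Z := by
  simp only [curv, map_sub, AddMonoidHom.sub_apply, nabla_smul_left, nabla_smul_right, map_add,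
    AddMonoidHom.add_apply, smul_sub]
  abel

lemma curv_add_left (X X' Y Z : V) : L.curv (X + X') Y Z = L.curv X Y Z + L.curv X' Y Z := by
  simp only [curv, map_sub, AddMonoidHom.sub_apply, map_add, AddMonoidHom.add_apply]
  abel

lemma curv₄_swap (X Y Z U : V) : L.curv₄ X Y Z U = -L.curv₄ Y X Z U := by
  simp [curv₄, L.curv_swap X Y]

lemma curv₄_smul_left (a : F) (X Y Z U : V) : L.curv₄ (a • X) Y Z U = a * L.curv₄ X Y Z U := by
  simp [curv₄, curv_smul_left]

lemma curv₄_add_left (X X' Y Z U : V) :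
    L.curv₄ (X + X') Y Z U = L.curv₄ X Y Z U + L.curv₄ X' Y Z U := by
  simp [curv₄, curv_add_left]

lemma curv₄_bianchi (X Y Z U : V) :
    L.curv₄ X Y Z U + L.curv₄ Y Z X U + L.curv₄ Z X Y U = 0 := by
  simpa [curv₄] using congrArg (fun v ↦ L.g v U) (L.curv_bianchi X Y Z)

/-- `[X, Y]` acts on functions as the commutator of `X` and `Y`: this is the coefficient of `ξ` in the
Jacobi identity for `X`, `Y` and `a ξ`, for any unit vector field `ξ`. -/
lemma D_bracket {ξ : V} (hξ : L.g ξ ξ = 1) (X Y : V) (a : F) :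
    L.D (L.nabla X Y - L.nabla Y X) a = L.D X (L.D Y a) - L.D Y (L.D X a) := by
  have h := congrArg (fun v ↦ L.g v ξ) (L.jacobi X Y (a • ξ))
  have h' := congrArg (fun v ↦ L.g (a • v) ξ) (L.jacobi X Y ξ)
  simp only [map_sub, map_add, AddMonoidHom.sub_apply, AddMonoidHom.add_apply, nabla_smul_left,
    nabla_smul_right, LinearMap.sub_apply, LinearMap.add_apply, map_smul, LinearMap.smul_apply,
    smul_eq_mul, hξ] at h h' ⊢
  linear_combination h' - h

lemma curv₄_skew {ξ : V} (hξ : L.g ξ ξ = 1) (X Y Z U : V) :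
    L.curv₄ X Y Z U = -L.curv₄ X Y U Z := by
  have h := L.D_bracket hξ X Y (L.g Z U)
  simp only [D_g, map_add, map_sub, AddMonoidHom.sub_apply] at h
  simp only [curv₄, curv, map_sub, AddMonoidHom.sub_apply, LinearMap.sub_apply]
  simp only [L.g_symm (L.nabla _ U), L.g_symm (L.nabla _ (L.nabla _ U))] at h ⊢
  linear_combination -h

lemma curv₄_pair_symm [IsAddTorsionFree F] {ξ : V} (hξ : L.g ξ ξ = 1) (X Y Z U : V) :
    L.curv₄ X Y Z U = L.curv₄ Z U X Y := by
  have h1 := L.curv₄_bianchi X Y Z U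
  have h2 := L.curv₄_bianchi Y Z U X
  have h3 := L.curv₄_bianchi Z U X Y
  have h4 := L.curv₄_bianchi U X Y Z
  have s := L.curv₄_swap
  have k := L.curv₄_skew hξ
  have key : 2 • (L.curv₄ X Y Z U - L.curv₄ Z U X Y) = 0 := by
    linear_combination h1 + h2 - h3 - h4 - k Y Z X U - k Z U Y X + k U X Z Y + k X Y U Z
      + (k X Z U Y - s X Z Y U) + (k Y U X Z - s Y U Z X)
  exact sub_eq_zero.1 ((nsmul_eq_zero_iff_right two_ne_zero).1 key)

lemma curv₄_bianchi_right [IsAddTorsionFree F] {ξ : V} (hξ : L.g ξ ξ = 1) (X Y Z U : V) :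
    L.curv₄ X Y Z U + L.curv₄ X Z U Y + L.curv₄ X U Y Z = 0 := by
  rw [L.curv₄_pair_symm hξ X Y, L.curv₄_pair_symm hξ X Z, L.curv₄_pair_symm hξ X U,
    L.curv₄_skew hξ Z U, L.curv₄_skew hξ U Y, L.curv₄_skew hξ Y Z]
  linear_combination -L.curv₄_bianchi Z U Y X

/-! ### Second covariant derivatives of an endomorphism -/

/-- The covariant derivative `(∇_Y φ) Z` of an endomorphism `φ`. -/
def covDeriv (φ : V →ₗ[F] V) (Y Z : V) : V := L.nabla Y (φ Z) - φ (L.nabla Y Z)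

/-- The second covariant derivative `(∇²_{W,Y} φ) Z` of an endomorphism `φ`. -/
def covDeriv₂ (φ : V →ₗ[F] V) (W Y Z : V) : V :=
  L.nabla W (L.covDeriv φ Y Z) - L.covDeriv φ (L.nabla W Y) Z - L.covDeriv φ Y (L.nabla W Z)

lemma ricci_identity (φ : V →ₗ[F] V) (W Y Z : V) :
    L.covDeriv₂ φ W Y Z - L.covDeriv₂ φ Y W Z = L.curv W Y (φ Z) - φ (L.curv W Y Z) := by
  simp only [covDeriv₂, covDeriv, curv, map_sub, AddMonoidHom.sub_apply]
  abel

section Skew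

variable {φ : V →ₗ[F] V} (hφ : ∀ X Y, L.g (φ X) Y = -L.g X (φ Y))
include hφ

lemma g_covDeriv_skew (Y Z U : V) :
    L.g (L.covDeriv φ Y Z) U = -L.g (L.covDeriv φ Y U) Z := by
  have h := congrArg (L.D Y) (hφ Z U)
  simp only [D_g, map_neg] at h
  simp only [covDeriv, map_sub, LinearMap.sub_apply, hφ] at h ⊢
  rw [L.g_symm _ Z, L.g_symm _ (φ Z)]
  have h2 := hφ Z (L.nabla Y U)
  linear_combination h + h2

lemma g_covDeriv₂_skew (W Y Z U : V) :
    L.g (L.covDeriv₂ φ W Y Z) U = -L.g (L.covDeriv₂ φ W Y U) Z := by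
  have h := congrArg (L.D W) (L.g_covDeriv_skew hφ Y Z U)
  simp only [D_g, map_neg] at h
  simp only [covDeriv₂, map_sub, LinearMap.sub_apply]
  linear_combination h - L.g_covDeriv_skew hφ (L.nabla W Y) Z U
    - L.g_covDeriv_skew hφ Y (L.nabla W Z) U - L.g_covDeriv_skew hφ Y Z (L.nabla W U)

/-- The Ricci identity for a skew endomorphism, in covariant form. -/
lemma curv₄_phi_skew (W Y Z U : V) :
    L.g (L.covDeriv₂ φ W Y Z) U - L.g (L.covDeriv₂ φ Y W Z) U =
      L.curv₄ W Y (φ Z) U + L.curv₄ W Y Z (φ U) := by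
  have h := congrArg (fun v ↦ L.g v U) (L.ricci_identity φ W Y Z)
  simp only [map_sub, LinearMap.sub_apply, hφ] at h
  simp only [curv₄]
  linear_combination h

end Skew

/-! ### The derivation by `φ` applied to the curvature tensor -/

/-- The Lie derivative `(L_ξ g)(X, Y) = g(∇_X ξ, Y) + g(∇_Y ξ, X)` of the metric. -/
def lieMetric (ξ X Y : V) : F :=
  L.g (L.nabla X ξ) Y + L.g (L.nabla Y ξ) X

section NearlySasakian

variable {φ : V →ₗ[F] V} {ξ : V}
  (hN : ∀ Y Z, L.covDeriv φ Y Z + L.covDeriv φ Z Y =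
    (2 * L.g Y Z) • ξ - L.g ξ Z • Y - L.g ξ Y • Z)
include hN

/-- The covariant derivative of the nearly Sasakian identity. -/
lemma g_covDeriv₂_add_swap (W Y Z U : V) :
    L.g (L.covDeriv₂ φ W Y Z) U + L.g (L.covDeriv₂ φ W Z Y) U =
      2 * L.g Y Z * L.g (L.nabla W ξ) U - L.g (L.nabla W ξ) Z * L.g Y U
        - L.g (L.nabla W ξ) Y * L.g Z U := by
  have e (Y Z : V) : L.g (L.covDeriv φ Y Z) U + L.g (L.covDeriv φ Z Y) U =
      2 * L.g Y Z * L.g ξ U - L.g ξ Z * L.g Y U - L.g ξ Y * L.g Z U := by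
    simpa using congrArg (fun v ↦ L.g v U) (hN Y Z)
  have h := congrArg (fun v ↦ L.g v U) (congrArg (L.nabla W) (hN Y Z))
  have hD : L.D W (2 * L.g Y Z) = 2 * L.D W (L.g Y Z) := by
    simp only [two_mul, map_add]
  simp only [map_add, map_sub, LinearMap.add_apply, LinearMap.sub_apply, nabla_smul_right,
    map_smul, LinearMap.smul_apply, smul_eq_mul, hD, D_g] at h
  simp only [covDeriv₂, map_sub, LinearMap.sub_apply]
  linear_combination h - e (L.nabla W Y) Z - e Y (L.nabla W Z)

variable (hφ : ∀ X Y, L.g (φ X) Y = -L.g X (φ Y))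
include hφ

/-- For a skew `φ` satisfying the nearly Sasakian identity, the derivation of the tensor algebra
defined by `φ` maps the curvature tensor to a Kulkarni-Nomizu product of `g` and `L_ξ g`. -/
theorem curv₄_phi_sum [IsAddTorsionFree F] (hξ : L.g ξ ξ = 1) (W Y Z U : V) :
    L.curv₄ (φ W) Y Z U + L.curv₄ W (φ Y) Z U + L.curv₄ W Y (φ Z) U + L.curv₄ W Y Z (φ U) =
      L.g Y Z * L.lieMetric ξ W U - L.g Y U * L.lieMetric ξ W Z
        - L.g W Z * L.lieMetric ξ Y U + L.g W U * L.lieMetric ξ Y Z := by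
  -- The subtracted tensor is the covariant derivative of the Sasakian `g(Y,Z)ξ - η(Z)Y`; the
  -- difference `B` is totally skew in `Y, Z, U`.
  let B (W Y Z U : V) : F := L.g (L.covDeriv₂ φ W Y Z) U
    - (L.g Y Z * L.g (L.nabla W ξ) U - L.g (L.nabla W ξ) Z * L.g Y U)
  have B1 (W Y Z U : V) : B W Y Z U = -B W Y U Z := by
    linear_combination L.g_covDeriv₂_skew hφ W Y Z U
  have B2 (W Y Z U : V) : B W Y Z U = -B W Z Y U := by
    linear_combination L.g_covDeriv₂_add_swap hN W Y Z U
      + L.g (L.nabla W ξ) U * L.g_symm Y Z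
  let alt (W Y Z U : V) : F := B W Y Z U - B Y W Z U + B Z W Y U - B U W Y Z
  let Φ (W Y Z U : V) : F :=
    L.curv₄ (φ W) Y Z U + L.curv₄ W (φ Y) Z U + L.curv₄ W Y (φ Z) U + L.curv₄ W Y Z (φ U)
  let K (W Y Z U : V) : F := L.g Y Z * L.lieMetric ξ W U - L.g Y U * L.lieMetric ξ W Z
        - L.g W Z * L.lieMetric ξ Y U + L.g W U * L.lieMetric ξ Y Z
  -- The Ricci identities for the pairs `W, Y` and `Z, U`, added with the pair symmetry of `R`.
  have key (W Y Z U : V) : Φ W Y Z U = K W Y Z U + alt W Y Z U := by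
    have h1 := L.curv₄_phi_skew hφ W Y Z U
    have h2 := L.curv₄_phi_skew hφ Z U W Y
    have h3 := L.curv₄_pair_symm hξ (φ W) Y Z U
    have h4 := L.curv₄_pair_symm hξ W (φ Y) Z U
    have h5 : B Z U W Y = B Z W Y U := by rw [B1 Z W, B2 Z W, neg_neg]
    have h6 : B U Z W Y = B U W Y Z := by rw [B1 U W, B2 U W, neg_neg]
    simp only [Φ, K, alt, B, lieMetric] at h5 h6 ⊢
    simp only [L.g_symm U, L.g_symm Z Y, L.g_symm Z W] at h1 h2 h5 h6 ⊢
    linear_combination h3 + h4 - h1 - h2 + h5 - h6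
  -- `alt` is totally skew, so its cyclic sum is `3 • alt`, while those of `Φ` and `K` vanish.
  have hΦ : Φ W Y Z U + Φ W Z U Y + Φ W U Y Z = 0 := by
    have b := L.curv₄_bianchi_right hξ
    linear_combination b (φ W) Y Z U + b W (φ Y) Z U + b W Y (φ Z) U + b W Y Z (φ U)
  have hK : K W Y Z U + K W Z U Y + K W U Y Z = 0 := by
    simp only [K, lieMetric]
    rw [L.g_symm Z Y, L.g_symm U Y, L.g_symm U Z]
    ring
  have halt : alt W Y Z U + alt W Z U Y + alt W U Y Z = 3 * alt W Y Z U := by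
    have h1 := B2 W Z Y U
    have h2 := B2 W U Y Z
    linear_combination B1 W Z U Y - h1 - B1 Z W U Y + B1 U W Z Y
      + h2 + B1 Y W U Z - B1 Z W U Y - B1 W Y Z U
  have h3 : 3 • alt W Y Z U = 0 := by
    linear_combination hΦ - hK - key W Y Z U - key W Z U Y - key W U Y Z - halt
  have h0 := (nsmul_eq_zero_iff_right three_ne_zero).1 h3
  linear_combination key W Y Z U + h0

end NearlySasakian

/-! ### Curvature in the direction of the characteristic vector field -/

section Characteristic

variable [IsAddTorsionFree F] {φ Q : V →ₗ[F] V} {ξ : V}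
  (hN : ∀ Y Z, L.covDeriv φ Y Z + L.covDeriv φ Z Y =
    (2 * L.g Y Z) • ξ - L.g ξ Z • Y - L.g ξ Y • Z)
  (hφ : ∀ X Y, L.g (φ X) Y = -L.g X (φ Y))
  (hξ : L.g ξ ξ = 1) (hφξ : φ ξ = 0)
include hξ

lemma g_nabla_unit (X : V) : L.g (L.nabla X ξ) ξ = 0 := by
  have h : L.D X 1 = 0 := by simpa using L.D_mul X 1 1
  rw [← hξ, D_g, L.g_symm ξ, ← two_nsmul] at h
  exact (nsmul_eq_zero_iff_right two_ne_zero).1 h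

include hN hφξ

lemma nabla_xi_xi [IsAddTorsionFree V] (hker : ∀ X, φ X = 0 → X = L.g ξ X • ξ) :
    L.nabla ξ ξ = 0 := by
  have h : 2 • φ (L.nabla ξ ξ) = 0 := by
    have h := hN ξ ξ
    simp only [covDeriv, hφξ, map_zero, hξ] at h
    rw [two_nsmul, ← neg_inj, neg_zero]
    calc _ = 0 - φ (L.nabla ξ ξ) + (0 - φ (L.nabla ξ ξ)) := by abel
      _ = _ := by rw [h]; module
  rw [hker _ ((nsmul_eq_zero_iff_right two_ne_zero).1 h), L.g_symm, L.g_nabla_unit hξ, zero_smul]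

include hφ

lemma curv₄_xi_phi_sum (hξξ : L.nabla ξ ξ = 0) {X Y Z : V}
    (hX : L.g X ξ = 0) (hY : L.g Y ξ = 0) :
    L.curv₄ (φ X) Y Z ξ + L.curv₄ X (φ Y) Z ξ + L.curv₄ X Y (φ Z) ξ = 0 := by
  have h := L.curv₄_phi_sum hN hφ hξ X Y Z ξ
  simp only [hφξ, hX, hY, lieMetric, hξξ, L.g_nabla_unit hξ] at h
  simpa [curv₄] using h

/-- `ker η` is curvature invariant, for vector fields orthogonal to `ξ` everywhere. The hypothesis
`hR` makes `φ² = -Q` act as `-1` in every slot of `R(X, Y, Z, ξ)`, and a trilinear form on which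
`φ ⊗ 1 ⊗ 1 + 1 ⊗ φ ⊗ 1 + 1 ⊗ 1 ⊗ φ` acts by zero then vanishes, as `±i ± i ± i ≠ 0`. -/
theorem curv₄_xi_eq_zero_of_horizontal [IsAddTorsionFree V]
    (hker : ∀ X, φ X = 0 → X = L.g ξ X • ξ)
    (hφφ : ∀ X, φ (φ X) = -Q X + L.g ξ X • ξ)
    (hR : ∀ X Y Z, L.g ξ Y = 0 → L.g ξ Z = 0 → L.curv₄ (Q X - X) Y Z ξ = 0)
    {X Y Z : V} (hX : L.g ξ X = 0) (hY : L.g ξ Y = 0) (hZ : L.g ξ Z = 0) :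
    L.curv₄ X Y Z ξ = 0 := by
  have hηφ (X : V) : L.g ξ (φ X) = 0 := by rw [L.g_symm, hφ, hφξ]; simp
  -- `φ²` acts as `-1` in each slot of the trilinear form `R(·, ·, ·, ξ)` on `ker η`.
  have h1 {X Y Z : V} (hX : L.g ξ X = 0) (hY : L.g ξ Y = 0) (hZ : L.g ξ Z = 0) :
      L.curv₄ (φ (φ X)) Y Z ξ = -L.curv₄ X Y Z ξ := by
    have e : φ (φ X) = (-1 : F) • (Q X - X) + (-1 : F) • X := by
      rw [hφφ, hX]; module
    rw [e, curv₄_add_left, curv₄_smul_left, curv₄_smul_left, hR X Y Z hY hZ]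
    ring
  have h2 {X Y Z : V} (hX : L.g ξ X = 0) (hY : L.g ξ Y = 0) (hZ : L.g ξ Z = 0) :
      L.curv₄ X (φ (φ Y)) Z ξ = -L.curv₄ X Y Z ξ := by
    rw [curv₄_swap, h1 hY hX hZ, L.curv₄_swap Y, neg_neg]
  have h3 {X Y Z : V} (hX : L.g ξ X = 0) (hY : L.g ξ Y = 0) (hZ : L.g ξ Z = 0) :
      L.curv₄ X Y (φ (φ Z)) ξ = -L.curv₄ X Y Z ξ := by
    linear_combination L.curv₄_bianchi X Y (φ (φ Z)) ξ + L.curv₄_bianchi X Y Z ξ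
      - h2 hY hZ hX - h1 hZ hX hY
  have hξξ := L.nabla_xi_xi hN hξ hφξ hker
  have hsum {X Y : V} (Z : V) (hX : L.g ξ X = 0) (hY : L.g ξ Y = 0) :=
    L.curv₄_xi_phi_sum hN hφ hξ hφξ hξξ (Z := Z) (L.g_symm X ξ ▸ hX) (L.g_symm Y ξ ▸ hY)
  -- Replacing `X` by `φX`, `Y` by `φY` and `Z` by `φZ` in `hsum` gives three linear equations for
  -- the values with `φ` in two slots.
  have half {X Y Z : V} (hX : L.g ξ X = 0) (hY : L.g ξ Y = 0) (hZ : L.g ξ Z = 0) :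
      2 * L.curv₄ (φ X) (φ Y) Z ξ = L.curv₄ X Y Z ξ := by
    linear_combination hsum Z (hηφ X) hY + hsum Z hX (hηφ Y) - hsum (φ Z) hX hY
      - h1 hX hY hZ - h2 hX hY hZ + h3 hX hY hZ
  have h : 3 • L.curv₄ X Y Z ξ = 0 := by
    have a := half (hηφ X) (hηφ Y) hZ
    rw [h1 hX (by simp [hηφ]) hZ, h2 hX hY hZ] at a
    linear_combination half hX hY hZ + 2 * a
  exact (nsmul_eq_zero_iff_right three_ne_zero).1 h

/-- The values of `R(X, Y, Z, ξ)` on vector fields that need not be orthogonal to `ξ`; the right-hand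
side vanishes at every point where `X` and `Y` are orthogonal to `ξ`. -/
theorem curv₄_xi_eq [IsAddTorsionFree V]
    (hker : ∀ X, φ X = 0 → X = L.g ξ X • ξ)
    (hφφ : ∀ X, φ (φ X) = -Q X + L.g ξ X • ξ)
    (hR : ∀ X Y Z, L.g ξ Y = 0 → L.g ξ Z = 0 → L.curv₄ (Q X - X) Y Z ξ = 0) (X Y Z : V) :
    L.curv₄ X Y Z ξ =
      L.g ξ X * L.curv₄ ξ Y Z ξ + L.g ξ Y * L.curv₄ (X - L.g ξ X • ξ) ξ Z ξ := by
  have hor (X : V) : L.g ξ (X - L.g ξ X • ξ) = 0 := by simp [hξ]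
  have dec (X : V) : X = X - L.g ξ X • ξ + L.g ξ X • ξ := by abel
  have split_left (X Y Z U : V) : L.curv₄ X Y Z U =
      L.curv₄ (X - L.g ξ X • ξ) Y Z U + L.g ξ X * L.curv₄ ξ Y Z U := by
    conv_lhs => rw [dec X, curv₄_add_left, curv₄_smul_left]
  have split_right (X Y Z U : V) : L.curv₄ X Y Z U =
      L.curv₄ X (Y - L.g ξ Y • ξ) Z U + L.g ξ Y * L.curv₄ X ξ Z U := by
    linear_combination L.curv₄_swap X Y Z U - split_left Y X Z U
      - L.curv₄_swap X (Y - L.g ξ Y • ξ) Z U - L.g ξ Y * L.curv₄_swap X ξ Z U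
  have hξξ (X Y : V) : L.curv₄ X Y ξ ξ = 0 := by
    have h : 2 • L.curv₄ X Y ξ ξ = 0 := by
      linear_combination L.curv₄_skew hξ X Y ξ ξ
    exact (nsmul_eq_zero_iff_right two_ne_zero).1 h
  have h := split_left Z ξ (X - L.g ξ X • ξ) (Y - L.g ξ Y • ξ)
  rw [L.curv₄_pair_symm hξ Z, L.curv₄_pair_symm hξ ξ, hξξ,
    L.curv₄_pair_symm hξ (Z - L.g ξ Z • ξ),
    L.curv₄_xi_eq_zero_of_horizontal hN hφ hξ hφξ hker hφφ hR (hor X) (hor Y) (hor Z)] at h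
  linear_combination split_left X Y Z ξ + split_right (X - L.g ξ X • ξ) Y Z ξ + h

end Characteristic

end LeviCivitaModule

noncomputable section

/-! ### The module of smooth vector fields of a Riemannian manifold -/

section SmoothFields

variable {E : Type*} [NormedAddCommGroup E] [NormedSpace ℝ E]
  {M : Type*} [TopologicalSpace M] [ChartedSpace E M] [IsManifold 𝓘(ℝ, E) ∞ M]

variable (E M) in
/-- The smooth vector fields on `M`, as bundled sections of the tangent bundle. -/
abbrev SmoothField := Cₛ^∞⟮𝓘(ℝ, E); E, (TangentSpace 𝓘(ℝ, E) : M → Type _)⟯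

lemma SmoothField.isSmooth (X : SmoothField E M) : IsSmoothVectorField (fun x ↦ X x) :=
  X.contMDiff

lemma SmoothField.mdifferentiableAt (X : SmoothField E M) (x : M) : MDiffAt (T% (fun x ↦ X x)) x :=
  (X.contMDiff x).mdifferentiableAt (by simp)

instance : SMul C^∞⟮𝓘(ℝ, E), M; ℝ⟯ (SmoothField E M) :=
  ⟨fun f X ↦ ⟨fun x ↦ f x • X x, f.contMDiff.smul_section X.contMDiff⟩⟩

@[simp]
lemma SmoothField.smul_apply (f : C^∞⟮𝓘(ℝ, E), M; ℝ⟯) (X : SmoothField E M) (x : M) :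
    (f • X) x = f x • X x := rfl

instance : Module C^∞⟮𝓘(ℝ, E), M; ℝ⟯ (SmoothField E M) where
  one_smul X := by ext x; simp
  mul_smul f h X := by ext x; simp [mul_smul]
  smul_zero f := by ext x; simp
  smul_add f X Y := by ext x; simp
  add_smul f h X := by ext x; simp [add_smul]
  zero_smul X := by ext x; simp

instance : IsAddTorsionFree C^∞⟮𝓘(ℝ, E), M; ℝ⟯ where
  nsmul_right_injective n hn f h hfh := by
    have h' := congrArg (((n : ℝ)⁻¹) • ·) hfh
    simpa [← Nat.cast_smul_eq_nsmul ℝ, smul_smul, hn] using h'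

instance : IsAddTorsionFree (SmoothField E M) where
  nsmul_right_injective n hn X Y h := by
    have h' := congrArg (((n : ℝ)⁻¹) • ·) h
    simpa [← Nat.cast_smul_eq_nsmul ℝ, smul_smul, hn] using h'

/-- The derivative `X f` of a smooth function along a smooth vector field. -/
def SmoothField.deriv (X : SmoothField E M) (f : C^∞⟮𝓘(ℝ, E), M; ℝ⟯) : C^∞⟮𝓘(ℝ, E), M; ℝ⟯ :=
  ⟨fun x ↦ d% f x (X x), by
    have h := (f.contMDiff.contMDiff_tangentMap (m := ∞) le_rfl).comp X.contMDiff
    exact contMDiff_snd_tangentBundle_modelSpace ℝ 𝓘(ℝ, ℝ) |>.comp h⟩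

/-- The action of a smooth `(1,1)`-tensor field on smooth vector fields. -/
def IsSmoothEndField.toLinearMap
    {T : Π x : M, TangentSpace 𝓘(ℝ, E) x →L[ℝ] TangentSpace 𝓘(ℝ, E) x} (hT : IsSmoothEndField T) :
    SmoothField E M →ₗ[C^∞⟮𝓘(ℝ, E), M; ℝ⟯] SmoothField E M where
  toFun X := ⟨fun x ↦ T x (X x), ContMDiff.clm_bundle_apply hT X.contMDiff⟩
  map_add' X Y := by ext x; simp
  map_smul' f X := by ext x; simp

variable [RiemannianBundle (fun x : M ↦ TangentSpace 𝓘(ℝ, E) x)]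
  {cov : CovariantDerivative 𝓘(ℝ, E) E (TangentSpace 𝓘(ℝ, E) : M → Type _)}

/-- The Levi-Civita connection on smooth vector fields, with `∇_X Y` written `hcov.nabla X Y`. -/
def IsLeviCivita.nabla (hcov : IsLeviCivita cov) :
    SmoothField E M →+ SmoothField E M →+ SmoothField E M :=
  AddMonoidHom.mk'
    (fun X ↦ AddMonoidHom.mk'
      (fun Y ↦ ⟨fun x ↦ cov (fun y ↦ Y y) x (X x), hcov.smooth _ _ X.isSmooth Y.isSmooth⟩)
      (fun Y Y' ↦ by
        ext x
        exact DFunLike.congr_fun (cov.isCovariantDerivativeOnUniv.add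
          (Y.mdifferentiableAt x) (Y'.mdifferentiableAt x)) (X x)))
    (fun X X' ↦ by ext Y x; exact map_add (cov (fun y ↦ Y y) x) (X x) (X' x))

lemma IsLeviCivita.coe_bracket (hcov : IsLeviCivita cov) (X Y : SmoothField E M) :
    (fun x ↦ (hcov.nabla X Y - hcov.nabla Y X) x) =
      VectorField.mlieBracket 𝓘(ℝ, E) (fun x ↦ X x) (fun x ↦ Y x) :=
  funext (hcov.torsion_free _ _ X.isSmooth Y.isSmooth)

lemma IsLeviCivita.jacobi [FiniteDimensional ℝ E] (hcov : IsLeviCivita cov)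
    (X Y Z : SmoothField E M) :
    hcov.nabla X (hcov.nabla Y Z - hcov.nabla Z Y)
        - hcov.nabla (hcov.nabla Y Z - hcov.nabla Z Y) X =
      hcov.nabla (hcov.nabla X Y - hcov.nabla Y X) Z
        - hcov.nabla Z (hcov.nabla X Y - hcov.nabla Y X)
      + (hcov.nabla Y (hcov.nabla X Z - hcov.nabla Z X)
        - hcov.nabla (hcov.nabla X Z - hcov.nabla Z X) Y) := by
  have hM : minSmoothness ℝ 3 = 3 := minSmoothness_of_isRCLikeNormedField
  have : IsManifold 𝓘(ℝ, E) (minSmoothness ℝ 3) M :=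
    IsManifold.of_le (n := ∞) (by rw [hM]; exact WithTop.coe_le_coe.2 le_top)
  have : CompleteSpace E := FiniteDimensional.complete ℝ E
  have sm (X : SmoothField E M) :
      ContMDiff 𝓘(ℝ, E) 𝓘(ℝ, E).tangent (minSmoothness ℝ 2)
        (fun x ↦ (⟨x, X x⟩ : TangentBundle 𝓘(ℝ, E) M)) := by
    rw [minSmoothness_of_isRCLikeNormedField]
    exact X.contMDiff.of_le (WithTop.coe_le_coe.2 le_top)
  have h := VectorField.leibniz_identity_mlieBracket (sm X) (sm Y) (sm Z)
  rw [← hcov.coe_bracket X Y, ← hcov.coe_bracket Y Z, ← hcov.coe_bracket X Z, ← hcov.coe_bracket,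
    ← hcov.coe_bracket, ← hcov.coe_bracket] at h
  ext x
  exact congrFun h x

variable [IsContMDiffRiemannianBundle 𝓘(ℝ, E) ∞ E (fun x : M ↦ TangentSpace 𝓘(ℝ, E) x)]

variable (E M) in
/-- The Riemannian metric, as a bilinear form on smooth vector fields. -/
def metricForm : SmoothField E M →ₗ[C^∞⟮𝓘(ℝ, E), M; ℝ⟯]
    SmoothField E M →ₗ[C^∞⟮𝓘(ℝ, E), M; ℝ⟯] C^∞⟮𝓘(ℝ, E), M; ℝ⟯ :=
  LinearMap.mk₂ _ (fun X Y ↦ ⟨fun x ↦ inner ℝ (X x) (Y x),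
      ContMDiff.inner_bundle (E := fun x : M ↦ TangentSpace 𝓘(ℝ, E) x) (b := fun x ↦ x)
        X.contMDiff Y.contMDiff⟩)
    (fun X X' Y ↦ by ext x; exact inner_add_left (X x) (X' x) (Y x))
    (fun f X Y ↦ by ext x; exact real_inner_smul_left (X x) (Y x) (f x))
    (fun X Y Y' ↦ by ext x; exact inner_add_right (X x) (Y x) (Y' x))
    (fun f X Y ↦ by ext x; exact real_inner_smul_right (X x) (Y x) (f x))

/-- The smooth vector fields of a Riemannian manifold form a `LeviCivitaModule` over the smooth
functions. -/
def IsLeviCivita.toModule [FiniteDimensional ℝ E] (hcov : IsLeviCivita cov) :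
    LeviCivitaModule C^∞⟮𝓘(ℝ, E), M; ℝ⟯ (SmoothField E M) where
  g := metricForm E M
  D := AddMonoidHom.mk'
    (fun X ↦ AddMonoidHom.mk' X.deriv (fun f h ↦ by
      ext x
      exact DFunLike.congr_fun (mvfderiv_fun_add ((f.contMDiff x).mdifferentiableAt (by simp))
        ((h.contMDiff x).mdifferentiableAt (by simp))) (X x)))
    (fun X X' ↦ by ext f x; exact map_add (d% (fun y ↦ f y) x) (X x) (X' x))
  nabla := hcov.nabla
  g_symm X Y := by ext x; exact real_inner_comm (Y x) (X x)
  D_mul X f h := by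
    ext x
    exact DFunLike.congr_fun (mvfderiv_fun_mul ((f.contMDiff x).mdifferentiableAt (by simp))
        ((h.contMDiff x).mdifferentiableAt (by simp))) (X x)
  nabla_smul_left f X Y := by ext x; exact map_smul (cov (fun y ↦ Y y) x) (f x) (X x)
  nabla_smul_right X f Y := by
    ext x
    exact DFunLike.congr_fun (cov.isCovariantDerivativeOnUniv.leibniz (Y.mdifferentiableAt x)
      ((f.contMDiff x).mdifferentiableAt (by simp))) (X x)
  D_g X Y Z := by ext x; exact hcov.metric _ _ _ X.isSmooth Y.isSmooth Z.isSmooth x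
  jacobi := hcov.jacobi

lemma IsLeviCivita.toModule_curv_apply [FiniteDimensional ℝ E] (hcov : IsLeviCivita cov)
    (X Y Z : SmoothField E M) (x : M) :
    hcov.toModule.curv X Y Z x =
      curvatureField cov (fun x ↦ X x) (fun x ↦ Y x) (fun x ↦ Z x) x := by
  rw [curvatureField, ← hcov.coe_bracket]
  rfl

end SmoothFields

/-! ### Pointwise properties of weak almost contact metric structures -/

section Pointwise

variable {E : Type*} [NormedAddCommGroup E] [NormedSpace ℝ E]
  {M : Type*} [TopologicalSpace M] [ChartedSpace E M] [IsManifold 𝓘(ℝ, E) ∞ M]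

namespace WeakAlmostContactStructure

variable (S : WeakAlmostContactStructure E M)

lemma phi_xi (x : M) : S.phi x (S.xi x) = 0 := by
  have h1 : S.phi x (S.phi x (S.xi x)) = 0 := by
    rw [S.phi_phi, S.Q_xi, S.eta_xi, one_smul, neg_add_cancel]
  -- `φ³ξ = 0` reads `Q(φξ) = η(φξ) ξ = Q(η(φξ) ξ)`.
  have h2 := S.phi_phi x (S.phi x (S.xi x))
  rw [h1, map_zero, eq_comm, neg_add_eq_zero] at h2
  have h3 : S.phi x (S.xi x) = S.eta x (S.phi x (S.xi x)) • S.xi x := by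
    apply (S.Q_nonsingular x).1
    rw [h2, map_smul, S.Q_xi]
  rw [h3, map_smul] at h1
  rcases smul_eq_zero.1 h1 with h | h
  · rw [h3, h, zero_smul]
  · exact h

lemma eq_smul_xi_of_phi_eq_zero {x : M} {v : TangentSpace 𝓘(ℝ, E) x} (hv : S.phi x v = 0) :
    v = S.eta x v • S.xi x := by
  have h := S.phi_phi x v
  rw [hv, map_zero, eq_comm, neg_add_eq_zero] at h
  apply (S.Q_nonsingular x).1
  rw [h, map_smul, S.Q_xi]

lemma eta_phi (x : M) (v : TangentSpace 𝓘(ℝ, E) x) : S.eta x (S.phi x v) = 0 := by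
  have h := S.phi_mem_ker x (v - S.eta x v • S.xi x) (by simp [S.eta_xi])
  simpa [S.phi_xi] using h

variable [RiemannianBundle (fun x : M ↦ TangentSpace 𝓘(ℝ, E) x)] {S}

lemma IsMetric.inner_xi (h : S.IsMetric) (x : M) (v : TangentSpace 𝓘(ℝ, E) x) :
    inner ℝ (S.xi x) v = S.eta x v := by
  have := h x v (S.xi x)
  rw [S.phi_xi, S.Q_xi, S.eta_xi, inner_zero_right, mul_one] at this
  rw [real_inner_comm]
  linarith

/-- `φ` is skew: the compatibility with the metric shows this on the image of `Q`, which is the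
whole tangent space. -/
lemma IsMetric.inner_phi (h : S.IsMetric) (x : M) (v w : TangentSpace 𝓘(ℝ, E) x) :
    inner ℝ (S.phi x v) w = -inner ℝ v (S.phi x w) := by
  -- `φQ = Qφ`, as both are `-φ³`.
  have comm (w : TangentSpace 𝓘(ℝ, E) x) : S.phi x (S.Q x w) = S.Q x (S.phi x w) := by
    have h1 := S.phi_phi x (S.phi x w)
    rw [S.eta_phi, zero_smul, add_zero, S.phi_phi x w, map_add, map_neg, map_smul, S.phi_xi,
      smul_zero, add_zero, neg_inj] at h1
    exact h1
  obtain ⟨u, rfl⟩ := (S.Q_nonsingular x).2 w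
  have h2 := h x v (S.phi x u)
  rw [S.phi_phi, S.eta_phi, inner_add_right, inner_neg_right, inner_smul_right,
    real_inner_comm (S.xi x), h.inner_xi, S.eta_phi] at h2
  rw [comm]
  linarith

end WeakAlmostContactStructure

end Pointwise

end

/-! ### Curvature invariance of the contact distribution -/

theorem proposition3p2 {n : ℕ} (hn : 1 ≤ n)
    {E : Type*} [NormedAddCommGroup E] [NormedSpace ℝ E] [FiniteDimensional ℝ E]
    (hE : Module.finrank ℝ E = 2 * n + 1)
    {M : Type*} [TopologicalSpace M] [T2Space M] [ChartedSpace E M] [IsManifold 𝓘(ℝ, E) ∞ M]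
    [RiemannianBundle (fun x : M ↦ TangentSpace 𝓘(ℝ, E) x)]
    [IsContMDiffRiemannianBundle 𝓘(ℝ, E) ∞ E (fun x : M ↦ TangentSpace 𝓘(ℝ, E) x)]
    (cov : CovariantDerivative 𝓘(ℝ, E) E (TangentSpace 𝓘(ℝ, E) : M → Type _))
    (hcov : IsLeviCivita cov)
    (S : WeakAlmostContactStructure E M) (hS : S.IsWeakNearlySasakian cov)
    (hR : ∀ X Y Z : Π x : M, TangentSpace 𝓘(ℝ, E) x,
      IsSmoothVectorField X → IsSmoothVectorField Y → IsSmoothVectorField Z →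
      ∀ x : M, S.eta x (Y x) = 0 → S.eta x (Z x) = 0 →
        S.eta x (curvatureField cov (fun y ↦ S.Qtilde y (X y)) Y Z x) = 0) :
    (∀ X Y Z : Π x : M, TangentSpace 𝓘(ℝ, E) x,
      IsSmoothVectorField X → IsSmoothVectorField Y → IsSmoothVectorField Z →
      ∀ x : M,
        inner ℝ (curvatureField cov S.xi Z (fun y ↦ S.phi y (X y)) x) (S.phi x (Y x)) = 0) ∧
    (∀ X Y Z : Π x : M, TangentSpace 𝓘(ℝ, E) x,
      IsSmoothVectorField X → IsSmoothVectorField Y → IsSmoothVectorField Z →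
      ∀ x : M, S.eta x (X x) = 0 → S.eta x (Y x) = 0 → S.eta x (Z x) = 0 →
        S.eta x (curvatureField cov X Y Z x) = 0) := by
  let L := hcov.toModule
  let φ := S.smooth_phi.toLinearMap
  let Q := S.smooth_Q.toLinearMap
  let ξ : SmoothField E M := ⟨S.xi, S.smooth_xi⟩
  have hη (X : SmoothField E M) (x : M) : L.g ξ X x = S.eta x (X x) := hS.isMetric.inner_xi x (X x)
  have htwo (x : M) : (2 : C^∞⟮𝓘(ℝ, E), M; ℝ⟯) x = 2 := by
    rw [← one_add_one_eq_two]
    exact one_add_one_eq_two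
  have hN (Y Z : SmoothField E M) : L.covDeriv φ Y Z + L.covDeriv φ Z Y =
      (2 * L.g Y Z) • ξ - L.g ξ Z • Y - L.g ξ Y • Z := by
    ext x
    have h := hS.nearly _ _ Y.isSmooth Z.isSmooth x
    rw [← hη, ← hη, ← htwo x] at h
    exact h
  have hφ (X Y : SmoothField E M) : L.g (φ X) Y = -L.g X (φ Y) := by
    ext x
    exact hS.isMetric.inner_phi x (X x) (Y x)
  have hξ : L.g ξ ξ = 1 := by
    ext x
    exact (hη ξ x).trans (S.eta_xi x)
  have hφξ : φ ξ = 0 := by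
    ext x
    exact S.phi_xi x
  have hker (X : SmoothField E M) (hX : φ X = 0) : X = L.g ξ X • ξ := by
    ext x
    rw [SmoothField.smul_apply, hη]
    exact S.eq_smul_xi_of_phi_eq_zero (DFunLike.congr_fun hX x)
  have hφφ (X : SmoothField E M) : φ (φ X) = -Q X + L.g ξ X • ξ := by
    ext x
    have h := S.phi_phi x (X x)
    rw [← hη] at h
    exact h
  have hcurv (X Y Z : SmoothField E M) (x : M) :
      L.curv₄ X Y Z ξ x =
        S.eta x (curvatureField cov (fun x ↦ X x) (fun x ↦ Y x) (fun x ↦ Z x) x) := by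
    rw [LeviCivitaModule.curv₄, L.g_symm, hη, hcov.toModule_curv_apply]
  have hRL (X Y Z : SmoothField E M) (hY : L.g ξ Y = 0) (hZ : L.g ξ Z = 0) :
      L.curv₄ (Q X - X) Y Z ξ = 0 := by
    ext x
    rw [hcurv]
    exact hR _ _ _ X.isSmooth Y.isSmooth Z.isSmooth x
      ((hη Y x).symm.trans (DFunLike.congr_fun hY x))
      ((hη Z x).symm.trans (DFunLike.congr_fun hZ x))
  have key := L.curv₄_xi_eq hN hφ hξ hφξ hker hφφ hRL
  -- `g(R_{ξ,Z} φX, φY) = R(φX, φY, ξ, Z) = -R(φX, φY, Z, ξ)` in the first claim.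
  refine ⟨fun X Y Z hX hY hZ x ↦ ?_, fun X Y Z hX hY hZ x hXx hYx _ ↦ ?_⟩
  · let X' : SmoothField E M := ⟨X, hX⟩
    let Y' : SmoothField E M := ⟨Y, hY⟩
    let Z' : SmoothField E M := ⟨Z, hZ⟩
    have hηφ (X : SmoothField E M) : L.g ξ (φ X) = 0 := by
      ext x
      exact (hη _ x).trans (S.eta_phi x (X x))
    have h : L.curv₄ ξ Z' (φ X') (φ Y') = 0 := by
      rw [L.curv₄_pair_symm hξ, L.curv₄_skew hξ, key, hηφ, hηφ, zero_mul, zero_mul, add_zero,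
        neg_zero]
    have hx := DFunLike.congr_fun h x
    rw [LeviCivitaModule.curv₄] at hx
    change inner ℝ (L.curv ξ Z' (φ X') x) _ = 0 at hx
    rwa [hcov.toModule_curv_apply] at hx
  · let X' : SmoothField E M := ⟨X, hX⟩
    let Y' : SmoothField E M := ⟨Y, hY⟩
    let Z' : SmoothField E M := ⟨Z, hZ⟩
    have h := DFunLike.congr_fun (key X' Y' Z') x
    rw [hcurv] at h
    refine h.trans ?_
    change L.g ξ X' x * _ + L.g ξ Y' x * _ = 0
    rw [hη, hη, show S.eta x (X' x) = 0 from hXx, show S.eta x (Y' x) = 0 from hYx, zero_mul,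
      zero_mul, add_zero]
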